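/- All graphs are finite. Let $D\ge 0$ be an integer. A $(D,F,F)$-coloring of a simple graph $G$ is a partition $(M,F)$ of $V(G)$ (one of the parts may be empty) such that the induced subgraph $G[M]$ is a forest of maximum degree at most $D$ and the induced subgraph $G[F]$ is a forest. A simple graph $G$ is $(D,F,F)$-critical if it has no $(D,F,F)$-coloring but every proper subgraph of $G$ has one. Theorem. Let $D\ge 2$ be an integer. Every $(D,F,F)$-critical simple graph $G$ with at least $3$ vertices satisfies $$|E(G)|\ \ge\ \frac{(6D+5)\,|V(G)|+3}{3(D+1)}.$$ Moreover, the bound is sharp: there are $(D,F,F)$-critical simple graphs $G$ with arbitrarily many vertices for which equality holds. -/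

import Mathlib

/-- `(M, Mᶜ)` is a `(D, F, F)`-coloring of `G`: the vertex set is partitioned into `M` and its
complement, `M` induces a forest of maximum degree at most `D`, and the complement of `M` induces
a forest. Either part may be empty. -/
structure IsDFFColoring {V : Type*} (G : SimpleGraph V) (D : ℕ) (M : Set V) : Prop where
  acyclic_left : (G.induce M).IsAcyclic
  degree_le : ∀ v : M, ((G.induce M).neighborSet v).encard ≤ D
  acyclic_right : (G.induce Mᶜ).IsAcyclic

/-- `G` admits a `(D, F, F)`-coloring. -/
def HasDFFColoring {V : Type*} (G : SimpleGraph V) (D : ℕ) : Prop :=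
  ∃ M : Set V, IsDFFColoring G D M

/-- `G` is `(D, F, F)`-critical: it admits no `(D, F, F)`-coloring, but every proper subgraph
(obtained by deleting vertices and/or edges, at least one of them) does. -/
def IsDFFCritical {V : Type*} (G : SimpleGraph V) (D : ℕ) : Prop :=
  ¬ HasDFFColoring G D ∧ ∀ H : G.Subgraph, H ≠ ⊤ → HasDFFColoring H.coe D

/-! The statement is generalised so that induction can run. Each vertex `v` carries a weight `k v ≤
D + 1`, and its degree inside `M` must be below `k v`; weight `0` forces `v` into the other class
`F`. The potential `pot` is scaled so that, at full weight `D + 1`, the claimed bound reads `pot ≤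
-3`. The core, `colOn_of_potGE`, says that potentials at least `-2` on all nonempty subsets suffice
for a colouring.

In a smallest counterexample `W`, let `A` be a proper nonempty subset of minimum potential. If `pot
A ≤ 3D + 1`, then `A` can be coloured first and the rest coloured around it (`colOn_of_pot_le`),
either by contracting `A ∩ F` to one vertex of weight `0` or by sharing the slack of a single edge
inside `M`. Hence every proper nonempty subset has potential at least `3D + 2`. This gap leaves room
to delete a vertex of degree 3 and lower its neighbours' weights, so vertices of weight at least 2
have degree at least 4. Summing over vertices then gives `pot W ≤ -#W ≤ -3`, a contradiction.

For criticality, a proper subset of potential below `-2` is colourable by assumption, and the same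
extension argument applies to it (`pot_le_of_not_colOn`).

For sharpness, start from a triangle of weight `0`, of potential `-3`. Attaching a triangle to a
vertex imitates lowering its weight by one and preserves the potential (`IsTight.attach`). Repeating
this until all weights are full gives unweighted extremal graphs. -/

section SparsePartition

open Finset
open scoped Classical

/-! ### Edge counts, forests and weighted colourings -/

section

variable {V : Type*}

/-- The number of ordered pairs in `A × B` that are adjacent in `G`. -/
noncomputable def adjCount (G : SimpleGraph V) (A B : Finset V) : ℤ :=
  ∑ u ∈ A, ∑ v ∈ B, if G.Adj u v then 1 else 0

/-- The number of edges of `G` with both ends in `A`. -/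
noncomputable def edgeCount (G : SimpleGraph V) (A : Finset V) : ℤ := adjCount G A A / 2

section Counting

variable (G : SimpleGraph V)

lemma adjCount_comm (A B : Finset V) : adjCount G A B = adjCount G B A := by
  unfold adjCount
  rw [sum_comm]
  simp only [G.adj_comm]

lemma adjCount_nonneg (A B : Finset V) : 0 ≤ adjCount G A B :=
  sum_nonneg fun _ _ => sum_nonneg fun _ _ => by split_ifs <;> norm_num

lemma adjCount_eq_sum (A B : Finset V) : adjCount G A B = ∑ u ∈ A, adjCount G {u} B := by
  simp [adjCount]

lemma adjCount_empty_left (B : Finset V) : adjCount G ∅ B = 0 := by simp [adjCount]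

lemma adjCount_empty_right (A : Finset V) : adjCount G A ∅ = 0 := by simp [adjCount]

lemma adjCount_singleton (u v : V) : adjCount G {u} {v} = if G.Adj u v then 1 else 0 := by
  simp only [adjCount, sum_singleton]

lemma adjCount_singleton_left (v : V) (B : Finset V) :
    adjCount G {v} B = #{u ∈ B | G.Adj v u} := by
  simp [adjCount]

lemma adjCount_eq_zero {A B : Finset V} (h : ∀ u ∈ A, ∀ v ∈ B, ¬ G.Adj u v) :
    adjCount G A B = 0 :=
  sum_eq_zero fun u hu => sum_eq_zero fun v hv => if_neg (h u hu v hv)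

lemma exists_adj_of_adjCount_pos {A B : Finset V} (h : 0 < adjCount G A B) :
    ∃ u ∈ A, ∃ v ∈ B, G.Adj u v := by
  by_contra! h'
  exact h.ne' (adjCount_eq_zero G h')

lemma edgeCount_singleton (v : V) : edgeCount G {v} = 0 := by
  simp [edgeCount, adjCount_singleton]

lemma edgeCount_empty : edgeCount G ∅ = 0 := by
  simp [edgeCount, adjCount_empty_left]

lemma edgeCount_congr {G' : SimpleGraph V} {A : Finset V}
    (h : ∀ u ∈ A, ∀ v ∈ A, G.Adj u v ↔ G'.Adj u v) : edgeCount G A = edgeCount G' A := by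
  unfold edgeCount adjCount
  congr 1
  exact sum_congr rfl fun u hu => sum_congr rfl fun v hv => by simp only [h u hu v hv]

lemma adjCount_congr {G' : SimpleGraph V} {A B : Finset V}
    (h : ∀ u ∈ A, ∀ v ∈ B, G.Adj u v ↔ G'.Adj u v) : adjCount G A B = adjCount G' A B :=
  sum_congr rfl fun u hu => sum_congr rfl fun v hv => by simp only [h u hu v hv]

variable [DecidableEq V]

lemma adjCount_union_left {A B : Finset V} (h : Disjoint A B) (C : Finset V) :
    adjCount G (A ∪ B) C = adjCount G A C + adjCount G B C := sum_union h

lemma adjCount_union_right {A B : Finset V} (h : Disjoint A B) (C : Finset V) :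
    adjCount G C (A ∪ B) = adjCount G C A + adjCount G C B := by
  rw [adjCount_comm, adjCount_union_left G h, adjCount_comm G A, adjCount_comm G B]

lemma adjCount_mono {A A' B B' : Finset V} (hA : A ⊆ A') (hB : B ⊆ B') :
    adjCount G A B ≤ adjCount G A' B' := by
  rw [← union_sdiff_of_subset hA, ← union_sdiff_of_subset hB,
    adjCount_union_left G disjoint_sdiff, adjCount_union_right G disjoint_sdiff]
  linarith [adjCount_nonneg G A (B' \ B), adjCount_nonneg G (A' \ A) (B ∪ B' \ B)]

lemma adjCount_pos {A B : Finset V} {u v : V} (hu : u ∈ A) (hv : v ∈ B) (h : G.Adj u v) :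
    1 ≤ adjCount G A B := by
  have := adjCount_mono G (singleton_subset_iff.2 hu) (singleton_subset_iff.2 hv)
  rwa [adjCount_singleton, if_pos h] at this

lemma even_adjCount_self (A : Finset V) : Even (adjCount G A A) := by
  induction A using Finset.induction_on with
  | empty => simp [adjCount]
  | insert a s ha ih =>
    have hd : Disjoint {a} s := disjoint_singleton_left.2 ha
    rw [insert_eq, adjCount_union_left G hd, adjCount_union_right G hd,
      adjCount_union_right G hd, adjCount_comm G s {a}, adjCount_singleton]
    obtain ⟨m, hm⟩ := ih
    exact ⟨adjCount G {a} s + m, by simp only [SimpleGraph.irrefl, if_false, hm]; ring⟩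

lemma two_mul_edgeCount (A : Finset V) : 2 * edgeCount G A = adjCount G A A :=
  Int.two_mul_ediv_two_of_even (even_adjCount_self G A)

lemma edgeCount_union {A B : Finset V} (h : Disjoint A B) :
    edgeCount G (A ∪ B) = edgeCount G A + edgeCount G B + adjCount G A B := by
  have h1 := two_mul_edgeCount G (A ∪ B)
  rw [adjCount_union_left G h, adjCount_union_right G h, adjCount_union_right G h,
    adjCount_comm G B A, ← two_mul_edgeCount, ← two_mul_edgeCount] at h1
  linarith

end Counting

/-- `S` induces a forest in `G`, in terms of edge counts. -/
def ForestOn (G : SimpleGraph V) (S : Finset V) : Prop :=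
  ∀ T ⊆ S, T.Nonempty → edgeCount G T + 1 ≤ #T

section Forest

variable {G : SimpleGraph V}

lemma forestOn_empty : ForestOn G ∅ := fun T hT hne => by
  exact absurd (subset_empty.1 hT) hne.ne_empty

lemma forestOn_singleton (v : V) : ForestOn G {v} := fun T hT hne => by
  rw [hne.subset_singleton_iff.1 hT, edgeCount_singleton]; simp

variable [DecidableEq V]

lemma ForestOn.union {S₁ S₂ : Finset V} (h₁ : ForestOn G S₁) (h₂ : ForestOn G S₂)
    (hd : Disjoint S₁ S₂) (hc : adjCount G S₁ S₂ ≤ 1) : ForestOn G (S₁ ∪ S₂) := by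
  intro T hT hne
  have hT' : T = (T ∩ S₁) ∪ (T ∩ S₂) := by
    rw [← inter_union_distrib_left, inter_eq_left.2 hT]
  have hd' : Disjoint (T ∩ S₁) (T ∩ S₂) := hd.mono inter_subset_right inter_subset_right
  rcases (T ∩ S₁).eq_empty_or_nonempty with h | ha
  · rw [h, empty_union] at hT'
    exact h₂ T (inter_eq_left.1 hT'.symm) hne
  rcases (T ∩ S₂).eq_empty_or_nonempty with h | hb
  · rw [h, union_empty] at hT'
    exact h₁ T (inter_eq_left.1 hT'.symm) hne
  have e := edgeCount_union G hd'
  have c := card_union_of_disjoint hd'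
  rw [← hT'] at e c
  have := h₁ _ inter_subset_right ha
  have := h₂ _ inter_subset_right hb
  have := adjCount_mono G (inter_subset_right (s₁ := T) (s₂ := S₁))
    (inter_subset_right (s₁ := T) (s₂ := S₂))
  push_cast [c]
  linarith

end Forest

variable [DecidableEq V]

/-- `M` is the first class of a partition of `W` into two induced forests of `G`, where the degree
of each `v ∈ M` in `M` is less than `k v`. -/
structure IsColOn (G : SimpleGraph V) (k : V → ℕ) (W M : Finset V) : Prop where
  subset : M ⊆ W
  forest_left : ForestOn G M
  degree_lt : ∀ v ∈ M, adjCount G {v} M < k v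
  forest_right : ForestOn G (W \ M)

/-- `W` has a partition as in `IsColOn`. -/
def ColOn (G : SimpleGraph V) (k : V → ℕ) (W : Finset V) : Prop := ∃ M, IsColOn G k W M

section Coloring

variable {G : SimpleGraph V} {k : V → ℕ} {W : Finset V}

lemma IsColOn.mono {k' : V → ℕ} {M : Finset V} (h : IsColOn G k' W M)
    (hk : ∀ v ∈ M, k' v ≤ k v) : IsColOn G k W M :=
  ⟨h.subset, h.forest_left, fun v hv => (h.degree_lt v hv).trans_le (by exact_mod_cast hk v hv),
    h.forest_right⟩

lemma colOn_empty : ColOn G k ∅ := ⟨∅, subset_rfl, forestOn_empty, by simp, forestOn_empty⟩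

/-- At most one edge joins the two left classes, so no cycle arises there, and only its two ends
gain a degree; `hdeg` asks for one unit of slack at them. -/
lemma IsColOn.union {A Z M₁ M₂ : Finset V} (h₁ : IsColOn G k A M₁) (h₂ : IsColOn G k Z M₂)
    (hd : Disjoint A Z) (hc : adjCount G M₁ M₂ ≤ 1)
    (hF : ForestOn G ((A \ M₁) ∪ (Z \ M₂)))
    (hdeg : ∀ u ∈ M₁, ∀ v ∈ M₂, G.Adj u v →
      adjCount G {u} M₁ + 1 < k u ∧ adjCount G {v} M₂ + 1 < k v) :
    IsColOn G k (A ∪ Z) (M₁ ∪ M₂) := by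
  have hdM : Disjoint M₁ M₂ := hd.mono h₁.subset h₂.subset
  refine ⟨union_subset_union h₁.subset h₂.subset, h₁.forest_left.union h₂.forest_left hdM hc,
    ?_, ?_⟩
  · intro v hv
    rw [adjCount_union_right G hdM]
    rcases mem_union.1 hv with hv | hv
    · have h1 := h₁.degree_lt v hv
      have h2 := adjCount_mono G (singleton_subset_iff.2 hv) (subset_refl M₂)
      rcases (adjCount_nonneg G {v} M₂).eq_or_lt with h0 | h0
      · linarith
      · obtain ⟨u, hu, w, hw, hadj⟩ := exists_adj_of_adjCount_pos G h0
        rw [mem_singleton] at hu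
        subst hu
        linarith [(hdeg u hv w hw hadj).1]
    · have h1 := h₂.degree_lt v hv
      have h2 := adjCount_mono G (singleton_subset_iff.2 hv) (subset_refl M₁)
      rw [adjCount_comm G M₂ M₁] at h2
      rcases (adjCount_nonneg G {v} M₁).eq_or_lt with h0 | h0
      · linarith
      · obtain ⟨u, hu, w, hw, hadj⟩ := exists_adj_of_adjCount_pos G h0
        rw [mem_singleton] at hu
        subst hu
        linarith [(hdeg w hw u hv hadj.symm).2]
  · convert hF using 1
    ext x
    have := @h₁.subset x
    have := @h₂.subset x
    have : x ∈ A → x ∉ Z := fun a => disjoint_left.1 hd a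
    simp only [mem_sdiff, mem_union]
    tauto

/-- The vertex `v` goes to the right class if it has at most one neighbour there. Otherwise at least
two of its neighbours are used up on the right, so at most one is in `M`, and `v` joins `M`. In the
degree 3 case the lowered weights `k'` supply the slack at that neighbour. -/
lemma colOn_of_erase {v : V} (hv : v ∈ W) {k' : V → ℕ} (h : ColOn G k' (W.erase v))
    (hk : ∀ u, k' u ≤ k u)
    (hdeg : adjCount G {v} (W.erase v) ≤ 1 ∨ (adjCount G {v} (W.erase v) ≤ 2 ∧ 1 ≤ k v) ∨
      (adjCount G {v} (W.erase v) ≤ 3 ∧ 2 ≤ k v ∧ ∀ u, G.Adj v u → k' u + 1 ≤ k u ∨ k' u = 0)) :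
    ColOn G k W := by
  obtain ⟨M, hM⟩ := h
  have hW : W.erase v ∪ {v} = W := by
    rw [union_comm, ← insert_eq, insert_erase hv]
  have hd : Disjoint (W.erase v) {v} := by simp
  have hsum : adjCount G {v} (W.erase v) = adjCount G {v} M + adjCount G {v} (W.erase v \ M) := by
    rw [← adjCount_union_right G disjoint_sdiff, union_sdiff_of_subset hM.subset]
  have hM' := hM.mono fun u _ => hk u
  have n1 := adjCount_nonneg G {v} M
  have n2 := adjCount_nonneg G {v} (W.erase v \ M)
  by_cases hF : adjCount G {v} (W.erase v \ M) ≤ 1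
  · have h0 : IsColOn G k {v} ∅ :=
      ⟨by simp, forestOn_empty, by simp, by simpa using forestOn_singleton v⟩
    refine ⟨_, hW ▸ hM'.union h0 hd (by simp [adjCount_empty_right]) ?_ (by simp)⟩
    rw [sdiff_empty]
    exact hM'.forest_right.union (forestOn_singleton v) (hd.mono_left sdiff_subset)
      (by rwa [adjCount_comm])
  · have hkv : adjCount G {v} M < k v ∧ adjCount G {v} M ≤ 1 := by
      rcases hdeg with h | ⟨h, h'⟩ | ⟨h, h', -⟩ <;> constructor <;> linarith
    have h0 : IsColOn G k {v} {v} := by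
      refine ⟨by simp, forestOn_singleton v, fun u hu => ?_, by simpa using forestOn_empty⟩
      rw [mem_singleton.1 hu, adjCount_singleton, if_neg (G.irrefl)]
      linarith [hkv.1]
    refine ⟨_, hW ▸ hM'.union h0 hd (by rw [adjCount_comm]; exact hkv.2) ?_ ?_⟩
    · rw [sdiff_self, bot_eq_empty, union_empty]
      exact hM'.forest_right
    · intro u hu w hw hadj
      rw [mem_singleton] at hw
      subst hw
      have h1 := adjCount_pos G (mem_singleton_self w) hu hadj.symm
      rw [adjCount_singleton, if_neg (G.irrefl)]
      rcases hdeg with h | ⟨h, h'⟩ | ⟨h, h', h''⟩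
      · linarith
      · linarith
      · have h3 := hM.degree_lt u hu
        have h4 := adjCount_nonneg G {u} M
        -- A neighbour with `k' u = 0` cannot lie in `M`, so the second alternative is void.
        rcases h'' u hadj.symm with h5 | h5
        · refine ⟨?_, ?_⟩ <;> push_cast at * <;> zify at * <;> linarith
        · rw [h5] at h3; push_cast at h3; linarith

end Coloring

end

/-! ### Potential and the colouring theorem -/

section

variable {V : Type*}

/-- The potential of `A`: each vertex `v` counts `3D + 2 + 3k(v)`, each edge `-(3D + 3)`. -/
noncomputable def pot (D : ℕ) (G : SimpleGraph V) (k : V → ℕ) (A : Finset V) : ℤ :=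
  ∑ v ∈ A, (3 * (D : ℤ) + 2 + 3 * k v) - (3 * D + 3) * edgeCount G A

section Potential

variable {D : ℕ} {G : SimpleGraph V} {k : V → ℕ}

lemma pot_sub_pot_le {k' : V → ℕ} {A : Finset V} {c : V → ℤ}
    (h : ∀ v ∈ A, 3 * (k v : ℤ) - 3 * k' v ≤ c v) :
    pot D G k A ≤ pot D G k' A + ∑ v ∈ A, c v := by
  unfold pot
  have : ∑ v ∈ A, (3 * (D : ℤ) + 2 + 3 * k v)
      ≤ ∑ v ∈ A, (3 * (D : ℤ) + 2 + 3 * k' v) + ∑ v ∈ A, c v := by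
    rw [← sum_add_distrib]
    exact sum_le_sum fun v hv => by linarith [h v hv]
  linarith

lemma pot_singleton (v : V) : pot D G k {v} = 3 * D + 2 + 3 * k v := by
  simp [pot, edgeCount_singleton]

lemma pot_empty : pot D G k ∅ = 0 := by
  simp [pot, edgeCount_empty]

lemma pot_congr {G' : SimpleGraph V} {k' : V → ℕ} {A : Finset V}
    (hG : ∀ u ∈ A, ∀ v ∈ A, G.Adj u v ↔ G'.Adj u v) (hk : ∀ v ∈ A, k v = k' v) :
    pot D G k A = pot D G' k' A := by
  unfold pot
  rw [edgeCount_congr G hG]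
  congr 1
  exact sum_congr rfl fun v hv => by rw [hk v hv]

variable [DecidableEq V]

lemma pot_union {A B : Finset V} (h : Disjoint A B) :
    pot D G k (A ∪ B) = pot D G k A + pot D G k B - (3 * D + 3) * adjCount G A B := by
  unfold pot
  rw [sum_union h, edgeCount_union G h]
  ring

lemma pot_insert {v : V} {A : Finset V} (h : v ∉ A) :
    pot D G k (insert v A) = pot D G k A + (3 * D + 2 + 3 * k v)
      - (3 * D + 3) * adjCount G {v} A := by
  rw [insert_eq, pot_union (disjoint_singleton_left.2 h), pot_singleton]
  ring

end Potential

/-- Every nonempty subset of `W` has potential at least `-2`. -/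
def PotGE (D : ℕ) (G : SimpleGraph V) (k : V → ℕ) (W : Finset V) : Prop :=
  ∀ A ⊆ W, A.Nonempty → -2 ≤ pot D G k A

/-- The graph on `Z ∪ {b}` which agrees with `G` on `Z` and in which `b` is joined to the
vertices of `Z` that have a neighbour in `F`. -/
def contractTo (G : SimpleGraph V) (Z F : Finset V) (b : V) : SimpleGraph V :=
  SimpleGraph.fromRel fun u v =>
    (u ∈ Z ∧ v ∈ Z ∧ G.Adj u v) ∨ (u = b ∧ v ∈ Z ∧ ∃ a ∈ F, G.Adj v a)

section Contract

variable {G : SimpleGraph V} {Z F : Finset V} {b : V}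

lemma contractTo_adj (hb : b ∉ Z) {u v : V} (hu : u ∈ Z) (hv : v ∈ Z) :
    (contractTo G Z F b).Adj u v ↔ G.Adj u v := by
  have h1 : u ≠ b := fun h => hb (h ▸ hu)
  have h2 : v ≠ b := fun h => hb (h ▸ hv)
  simp only [contractTo, SimpleGraph.fromRel_adj, hu, hv, h1, h2, true_and, false_and, or_false,
    G.adj_comm v u, or_self, and_iff_right_iff_imp]
  exact fun h => h.ne

lemma contractTo_adj_left (hb : b ∉ Z) {v : V} (hv : v ∈ Z) :
    (contractTo G Z F b).Adj b v ↔ ∃ a ∈ F, G.Adj v a := by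
  have h2 : v ≠ b := fun h => hb (h ▸ hv)
  simp [contractTo, SimpleGraph.fromRel_adj, hv, h2, h2.symm, hb]

/-- By `h1` contraction creates no parallel edges, so the simple graph loses none of the edges to
`F`. -/
lemma adjCount_contractTo [DecidableEq V] (hb : b ∉ Z) (h1 : ∀ v ∈ Z, adjCount G {v} F ≤ 1) {Y : Finset V}
    (hY : Y ⊆ Z) : adjCount (contractTo G Z F b) {b} Y = adjCount G Y F := by
  rw [adjCount_comm, adjCount_eq_sum _ Y, adjCount_eq_sum _ Y]
  refine sum_congr rfl fun v hv => ?_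
  rw [adjCount_singleton, SimpleGraph.adj_comm, contractTo_adj_left hb (hY hv)]
  split_ifs with h
  · obtain ⟨a, ha, hva⟩ := h
    exact le_antisymm (adjCount_pos G (mem_singleton_self v) ha hva) (h1 v (hY hv))
  · push Not at h
    exact (adjCount_eq_zero G fun u hu a ha => by rw [mem_singleton.1 hu]; exact h a ha).symm

end Contract

section Gap

variable [DecidableEq V] {D : ℕ} {G : SimpleGraph V} {k : V → ℕ} {W A : Finset V}

/-- The class `F = A \ M` is replaced by one vertex `b` of weight `0`, and neighbours of `M` outside
`A` are forced to the right by weight `0`. No edge then joins the two left classes, and a forest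
through `b` stays a forest when `b` is expanded to the forest `F`. -/
lemma colOn_of_contract {M : Finset V} (hAW : A ⊆ W) (hk : ∀ v, k v ≤ D + 1)
    (hone : ∀ v ∈ W \ A, adjCount G {v} A ≤ 1)
    (IH : ∀ (W' : Finset V), #W' < #W → ∀ (G' : SimpleGraph V) (k' : V → ℕ),
      (∀ v, k' v ≤ D + 1) → PotGE D G' k' W' → ColOn G' k' W')
    (hW : -2 ≤ pot D G k W)
    (hmin : ∀ B ⊆ W, B.Nonempty → B ≠ W → pot D G k A ≤ pot D G k B)
    (hr : pot D G k A ≤ 3 * D + 1) (hcard : 2 ≤ #A) (hM : IsColOn G k A M)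
    (hcross : 0 < adjCount G (W \ A) (A \ M)) : ColOn G k W := by
  set Z := W \ A with hZ
  have hd : Disjoint A Z := disjoint_sdiff
  have hAZ : A ∪ Z = W := union_sdiff_of_subset hAW
  obtain ⟨v₀, hv₀, b, hb, hadj₀⟩ := exists_adj_of_adjCount_pos G hcross
  have hbA : b ∈ A := (mem_sdiff.1 hb).1
  have hbZ : b ∉ Z := fun h => disjoint_left.1 hd hbA h
  set F := A \ M with hF
  have hone' : ∀ v ∈ Z, adjCount G {v} F ≤ 1 := fun v hv =>
    (adjCount_mono G subset_rfl sdiff_subset).trans (hone v hv)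
  set G' := contractTo G Z F b with hG'
  set k' : V → ℕ := fun v => if v = b ∨ 0 < adjCount G {v} M then 0 else k v with hk'
  have hk'b : k' b = 0 := by simp [hk']
  have hk'k : ∀ v, k' v ≤ k v := fun v => by simp only [hk']; split_ifs <;> simp
  have hadjG : ∀ Y ⊆ Z, ∀ u ∈ Y, ∀ v ∈ Y, G.Adj u v ↔ G'.Adj u v := fun Y hY u hu v hv =>
    (contractTo_adj hbZ (hY hu) (hY hv)).symm
  -- Zeroing a weight costs at most `3(D + 1)`, which is the price of one of the edges to `M` that
  -- are dropped.
  have hpotY : ∀ Y ⊆ Z, pot D G k (Y ∪ A) + (3 * D + 3) * adjCount G Y F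
      ≤ pot D G' k' Y + pot D G k A := by
    intro Y hY
    have h1 : pot D G k Y ≤ pot D G k' Y + ∑ v ∈ Y, (3 * (D : ℤ) + 3) * adjCount G {v} M := by
      refine pot_sub_pot_le fun v hv => ?_
      have hvb : v ≠ b := fun h => hbZ (h ▸ hY hv)
      have hkv : (k v : ℤ) ≤ D + 1 := by exact_mod_cast hk v
      have hn := adjCount_nonneg G {v} M
      simp only [hk', hvb, false_or]
      split_ifs with h
      · have : (1 : ℤ) ≤ adjCount G {v} M := h
        push_cast
        nlinarith
      · have : adjCount G {v} M = 0 := le_antisymm (not_lt.1 h) hn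
        rw [this]; simp
    rw [← mul_sum, ← adjCount_eq_sum] at h1
    have h2 := pot_union (D := D) (G := G) (k := k) (hd.symm.mono_left hY)
    have h3 : adjCount G Y A = adjCount G Y M + adjCount G Y F := by
      rw [← adjCount_union_right G disjoint_sdiff, union_sdiff_of_subset hM.subset]
    rw [h3] at h2
    rw [pot_congr (hadjG Y hY) (k' := k') (fun _ _ => rfl)] at h1
    linarith
  have hgood : PotGE D G' k' (insert b Z) := by
    intro X hX hne
    by_cases hbX : b ∈ X
    · have hY : X.erase b ⊆ Z := by
        intro x hx
        exact (mem_insert.1 (hX (mem_of_mem_erase hx))).resolve_left (ne_of_mem_erase hx)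
      have h1 := hpotY _ hY
      rw [← insert_erase hbX, pot_insert (notMem_erase b X), hk'b,
        adjCount_contractTo hbZ hone' hY]
      push_cast
      -- The vertex `b` contributes `3D + 2`. If the union is `W`, the new potential is at least `-2
      -- - (3D + 1) + (3D + 2) = -1`; otherwise minimality of `A` gives at least `3D + 2`.
      by_cases h : X.erase b ∪ A = W
      · rw [h] at h1
        linarith
      · have := hmin _ (union_subset (hY.trans sdiff_subset) hAW) ⟨b, by simp [hbA]⟩ h
        linarith
    · have hY : X ⊆ Z := fun x hx =>
        (mem_insert.1 (hX hx)).resolve_left fun h => hbX (h ▸ hx)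
      have h1 := hpotY _ hY
      have h3 := adjCount_nonneg G X F
      by_cases h : X ∪ A = W
      · have : X = Z := by
          rw [hZ, ← h, union_sdiff_right, sdiff_eq_self_of_disjoint (hd.symm.mono_left hY)]
        subst this
        rw [h] at h1
        -- Without `b`, the dropped crossing edge is what compensates for `pot A ≤ 3D + 1`.
        have : (1 : ℤ) ≤ adjCount G Z F := hcross
        nlinarith
      · have := hmin _ (union_subset (hY.trans sdiff_subset) hAW) (hne.mono subset_union_left) h
        nlinarith
  obtain ⟨M', hM'⟩ := IH (insert b Z) (by
    have h1 := card_insert_le b Z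
    have h2 := card_union_of_disjoint hd
    rw [hAZ] at h2
    omega) G' k' (fun v => (hk'k v).trans (hk v)) hgood
  have hbM' : b ∉ M' := fun h => by
    have h1 := hM'.degree_lt b h
    have h2 := adjCount_nonneg G' {b} M'
    rw [hk'b] at h1
    push_cast at h1
    linarith
  have hM'Z : M' ⊆ Z := fun x hx =>
    (mem_insert.1 (hM'.subset hx)).resolve_left fun h => hbM' (h ▸ hx)
  have hforest : ∀ S ⊆ Z, ForestOn G' S → ForestOn G S := fun S hS h T hT hne => by
    rw [edgeCount_congr G (hadjG T (hT.trans hS))]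
    exact h T hT hne
  have hF' : insert b Z \ M' = insert b (Z \ M') := insert_sdiff_of_notMem _ hbM'
  have hFr := hM'.forest_right
  rw [hF'] at hFr
  have hM'' : IsColOn G k Z M' := by
    refine ⟨hM'Z, hforest _ hM'Z hM'.forest_left, fun v hv => ?_,
      hforest _ sdiff_subset fun T hT => hFr T (hT.trans (subset_insert _ _))⟩
    have h1 := hM'.degree_lt v hv
    rw [← adjCount_congr G fun u hu w hw => ?_] at h1
    · exact h1.trans_le (by exact_mod_cast hk'k v)
    · rw [mem_singleton.1 hu]
      exact hadjG M' hM'Z v hv w hw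
  have hno : ∀ u ∈ M, ∀ v ∈ M', ¬ G.Adj u v := by
    intro u hu v hv hadj
    have h1 := adjCount_pos G (mem_singleton_self v) hu hadj.symm
    have h2 := hM'.degree_lt v hv
    have h3 := adjCount_nonneg G' {v} M'
    have h4 : k' v = 0 := if_pos (Or.inr h1)
    rw [h4] at h2
    push_cast at h2
    linarith
  refine ⟨M ∪ M', hAZ ▸ hM.union hM'' hd (by rw [adjCount_eq_zero G hno]; norm_num) ?_
    fun u hu v hv hadj => (hno u hu v hv hadj).elim⟩
  rw [← hF]
  intro T hT hne
  have hT' : T = (T ∩ F) ∪ (T ∩ (Z \ M')) := by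
    rw [← inter_union_distrib_left, inter_eq_left.2 hT]
  have hd' : Disjoint (T ∩ F) (T ∩ (Z \ M')) :=
    hd.mono (inter_subset_right.trans sdiff_subset) (inter_subset_right.trans sdiff_subset)
  rcases (T ∩ F).eq_empty_or_nonempty with h | ha
  · rw [h, empty_union] at hT'
    exact hM''.forest_right T (inter_eq_left.1 hT'.symm) hne
  have e := edgeCount_union G hd'
  have c := card_union_of_disjoint hd'
  rw [← hT'] at e c
  set Y := T ∩ (Z \ M') with hY
  have hYZ : Y ⊆ Z := inter_subset_right.trans sdiff_subset
  -- The bounds for `T ∩ F` and for `Y` together with `b` add up: the vertex `b` accounts for the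
  -- one edge lost in the second bound.
  have h1 := hM.forest_right _ inter_subset_right ha
  have h2 := hFr (insert b Y) (insert_subset_insert _ inter_subset_right) (insert_nonempty _ _)
  have hbY : b ∉ Y := fun h => hbZ (hYZ h)
  rw [card_insert_of_notMem hbY, insert_eq, edgeCount_union G' (disjoint_singleton_left.2 hbY),
    edgeCount_singleton, ← edgeCount_congr G (hadjG Y hYZ), adjCount_contractTo hbZ hone' hYZ] at h2
  have h3 := adjCount_mono G (inter_subset_right (s₁ := T) (s₂ := F)) (subset_refl Y)
  rw [adjCount_comm G F] at h3
  push_cast [c] at *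
  linarith

/-- All edges leaving `A` end in `M`, so the right classes glue freely. Every outside neighbour of
`A` except `c` is forced to the right, and the edge `bc` may survive inside the left class. The
budget `D + 1` is split: `b` gives up `t` and `c` gives up `D + 1 - t`. Keeping `3t` of potential at
`c` pays for `pot A`. -/
lemma colOn_of_cross_left {M : Finset V} (hAW : A ⊆ W) (hA : A.Nonempty) (hk : ∀ v, k v ≤ D + 1)
    (IH : ∀ (W' : Finset V), #W' < #W → ∀ (k' : V → ℕ),
      (∀ v, k' v ≤ D + 1) → PotGE D G k' W' → ColOn G k' W')
    (hW : -2 ≤ pot D G k W)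
    (hmin : ∀ B ⊆ W, B.Nonempty → B ≠ W → pot D G k A ≤ pot D G k B)
    (hone : ∀ v ∈ W \ A, adjCount G {v} A ≤ 1)
    {t : ℕ} (ht : pot D G k A ≤ 3 * t) {b c : V} (hb : b ∈ A) (hc : c ∈ W \ A) (hbc : G.Adj c b)
    (hM : IsColOn G (Function.update k b (k b - t)) A M)
    (hcross : adjCount G (W \ A) (A \ M) = 0) : ColOn G k W := by
  set Z := W \ A with hZ
  have hd : Disjoint A Z := disjoint_sdiff
  have hAZ : A ∪ Z = W := union_sdiff_of_subset hAW
  have hbM : b ∈ M := by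
    by_contra h
    have := adjCount_pos G hc (mem_sdiff.2 ⟨hb, h⟩) hbc
    linarith
  have hbdeg := hM.degree_lt b hbM
  have hn := adjCount_nonneg G {b} M
  rw [Function.update_self] at hbdeg
  have hkb := hk b
  have htD : t ≤ D := by omega
  have hMk : IsColOn G k A M := hM.mono fun v _ => by
    by_cases h : v = b
    · subst h; simp
    · simp [h]
  set k' : V → ℕ := fun v => if v = c then k v - (D + 1 - t) else
    if 0 < adjCount G {v} A then 0 else k v with hk'
  have hk'k : ∀ v, k' v ≤ k v := fun v => by simp only [hk']; split_ifs <;> simp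
  have hpotY : ∀ Y ⊆ Z, pot D G k (Y ∪ A) + (if c ∈ Y then 3 * (t : ℤ) else 0)
      ≤ pot D G k' Y + pot D G k A := by
    intro Y hY
    have h1 : pot D G k Y ≤ pot D G k' Y + ∑ v ∈ Y, ((3 * (D : ℤ) + 3) * adjCount G {v} A
        - if c = v then 3 * (t : ℤ) else 0) := by
      refine pot_sub_pot_le fun v hv => ?_
      have hkv : (k v : ℤ) ≤ D + 1 := by exact_mod_cast hk v
      have hn := adjCount_nonneg G {v} A
      by_cases hvc : v = c
      · have : 1 ≤ adjCount G {v} A :=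
          adjCount_pos G (mem_singleton_self v) hb (hvc ▸ hbc)
        have h2 : (k v : ℤ) - k' v ≤ D + 1 - t := by
          simp only [hk', hvc, if_true]
          omega
        rw [if_pos hvc.symm]
        nlinarith
      · rw [if_neg (Ne.symm hvc)]
        simp only [hk', hvc, if_false]
        split_ifs with h
        · have : (1 : ℤ) ≤ adjCount G {v} A := h
          push_cast
          nlinarith
        · nlinarith
    rw [sum_sub_distrib, ← mul_sum, ← adjCount_eq_sum, sum_ite_eq] at h1
    have h2 := pot_union (D := D) (G := G) (k := k) (hd.symm.mono_left hY)
    linarith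
  have hgood : PotGE D G k' Z := by
    intro Y hY hne
    have h1 := hpotY Y hY
    by_cases h : Y ∪ A = W
    · have : Y = Z := by
        rw [hZ, ← h, union_sdiff_right, sdiff_eq_self_of_disjoint (hd.symm.mono_left hY)]
      rw [if_pos (this ▸ hc), h] at h1
      linarith
    · have := hmin _ (union_subset (hY.trans sdiff_subset) hAW) (hne.mono subset_union_left) h
      have h2 : (0 : ℤ) ≤ if c ∈ Y then 3 * (t : ℤ) else 0 := by split_ifs <;> positivity
      linarith
  have hcardlt : #Z < #W := card_lt_card (sdiff_ssubset hAW hA)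
  obtain ⟨M', hM'⟩ := IH Z hcardlt k' (fun v => (hk'k v).trans (hk v)) hgood
  have honly : ∀ v ∈ M', 0 < adjCount G {v} A → v = c := by
    intro v hv hpos
    by_contra hvc
    have h2 := hM'.degree_lt v hv
    have h3 := adjCount_nonneg G {v} M'
    have h4 : k' v = 0 := by simp only [hk', hvc, if_false, hpos, if_true]
    rw [h4] at h2
    push_cast at h2
    linarith
  have hcb : ∀ u ∈ A, G.Adj c u → u = b := by
    intro u hu hadj
    by_contra hub
    have h1 := hone c hc
    have h2 := adjCount_mono G (subset_refl {c}) (insert_subset hu (singleton_subset_iff.2 hb))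
    rw [insert_eq, adjCount_union_right G (by simpa using hub), adjCount_singleton,
      adjCount_singleton, if_pos hadj, if_pos hbc] at h2
    linarith
  have hMM : ∀ u ∈ M, ∀ v ∈ M', G.Adj u v → u = b ∧ v = c := by
    intro u hu v hv hadj
    have := honly v hv (adjCount_pos G (mem_singleton_self v) (hM.subset hu) hadj.symm)
    subst this
    exact ⟨hcb u (hM.subset hu) hadj.symm, rfl⟩
  refine ⟨M ∪ M', hAZ ▸ hMk.union (hM'.mono fun v _ => hk'k v) hd ?_ ?_ ?_⟩
  · by_cases hcM : c ∈ M'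
    · refine le_trans ?_ (hone c hc)
      rw [adjCount_comm, adjCount_eq_sum]
      rw [sum_eq_single_of_mem c hcM]
      · exact adjCount_mono G subset_rfl hM.subset
      · intro v hv hvc
        refine adjCount_eq_zero G fun u hu w hw hadj => hvc ?_
        rw [mem_singleton.1 hu] at hadj
        exact (hMM w hw v hv hadj.symm).2
    · rw [adjCount_eq_zero G fun u hu v hv hadj => hcM ((hMM u hu v hv hadj).2 ▸ hv)]
      norm_num
  · refine hM.forest_right.union hM'.forest_right (hd.mono sdiff_subset sdiff_subset) ?_
    have := adjCount_mono G (sdiff_subset (s := Z) (t := M')) (subset_refl (A \ M))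
    rw [adjCount_comm]
    linarith
  · intro u hu v hv hadj
    obtain ⟨rfl, rfl⟩ := hMM u hu v hv hadj
    have h1 := hM'.degree_lt v hv
    have h2 := adjCount_nonneg G {v} M'
    have h3 : k' v = k v - (D + 1 - t) := by simp only [hk', if_true]
    have h4 := hk v
    rw [h3] at h1
    -- If `t = 0`, the reduced weight of `c` is `0`, contradicting `c ∈ M'`. Otherwise `1 ≤ t ≤ D`
    -- and both ends have slack.
    omega

/-- A proper set of small minimum potential can be contracted. -/
lemma colOn_of_pot_le (hAW : A ⊆ W) (hA : A.Nonempty) (hne : A ≠ W) (hk : ∀ v, k v ≤ D + 1)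
    (IH : ∀ (W' : Finset V), #W' < #W → ∀ (G' : SimpleGraph V) (k' : V → ℕ),
      (∀ v, k' v ≤ D + 1) → PotGE D G' k' W' → ColOn G' k' W')
    (hW : -2 ≤ pot D G k W)
    (hmin : ∀ B ⊆ W, B.Nonempty → B ≠ W → pot D G k A ≤ pot D G k B)
    (hr : pot D G k A ≤ 3 * D + 1)
    (hdeg : ∀ v ∈ W, 2 ≤ adjCount G {v} (W.erase v) ∧
      (1 ≤ k v → 3 ≤ adjCount G {v} (W.erase v)))
    {t : ℕ} (ht : pot D G k A ≤ 3 * t)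
    (hcol : ∀ b ∈ A, ColOn G (Function.update k b (k b - t)) A) : ColOn G k W := by
  have hd : Disjoint A (W \ A) := disjoint_sdiff
  have hAZ : A ∪ (W \ A) = W := union_sdiff_of_subset hAW
  have hone : ∀ v ∈ W \ A, adjCount G {v} A ≤ 1 := by
    intro v hv
    obtain ⟨hvW, hvA⟩ := mem_sdiff.1 hv
    have h1 := pot_insert (D := D) (G := G) (k := k) hvA
    have hkv : (k v : ℤ) ≤ D + 1 := by exact_mod_cast hk v
    -- Two edges to `A` cost `6D + 6`, more than the `6D + 5` a vertex can bring, against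
    -- minimality. If `v` completes `W`, the degree bounds push `pot W` down to at most `-3`.
    by_contra! hlt
    by_cases h : insert v A = W
    · have h2 := hdeg v hvW
      rw [← h, erase_insert hvA] at h2
      rw [h] at h1
      rcases Nat.eq_zero_or_pos (k v) with h0 | h0
      · rw [h0] at h1
        push_cast at h1
        nlinarith
      · have := h2.2 h0
        nlinarith
    · have := hmin _ (insert_subset hvW hAW) (insert_nonempty _ _) h
      nlinarith
  have hcard : 2 ≤ #A := by
    by_contra! hlt
    have : #A = 1 := by have := hA.card_pos; omega
    obtain ⟨a, rfl⟩ := card_eq_one.1 this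
    rw [pot_singleton] at hr
    linarith [(Nat.cast_nonneg (k a) : (0 : ℤ) ≤ k a)]
  have hmono : ∀ b M, IsColOn G (Function.update k b (k b - t)) A M → IsColOn G k A M :=
    fun b M hM => hM.mono fun v _ => by
      by_cases h : v = b
      · subst h; simp
      · simp [h]
  by_cases hc : 0 < adjCount G (W \ A) A
  · obtain ⟨c, hc, b, hb, hadj⟩ := exists_adj_of_adjCount_pos G hc
    obtain ⟨M, hM⟩ := hcol b hb
    rcases (adjCount_nonneg G (W \ A) (A \ M)).eq_or_lt with h0 | h0
    · exact colOn_of_cross_left hAW hA hk (fun W' h k' => IH W' h G k') hW hmin hone ht hb hc hadj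
        hM h0.symm
    · exact colOn_of_contract hAW hk hone IH hW hmin hr hcard (hmono b M hM) h0
  · have h0 : adjCount G (W \ A) A = 0 := le_antisymm (not_lt.1 hc) (adjCount_nonneg G _ _)
    obtain ⟨b, hb⟩ := hA
    obtain ⟨M, hM⟩ := hcol b hb
    have hgood : PotGE D G k (W \ A) := by
      intro Y hY hYne
      have h1 := pot_union (D := D) (G := G) (k := k) (hd.symm.mono_left hY)
      have h2 := adjCount_mono G hY (subset_refl A)
      have h3 := adjCount_nonneg G Y A
      have h4 : adjCount G Y A = 0 := by linarith
      rw [h4] at h1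
      -- With no crossing edges, `pot Y + pot A = pot (Y ∪ A)`. If the union is `W`, then `pot A ≤
      -- pot Y` yields `2 pot Y ≥ -2`.
      have h5 := hmin Y (hY.trans sdiff_subset) hYne (by
        rintro rfl
        exact (disjoint_left.1 hd hb) (hY (hAW hb)))
      by_cases h : Y ∪ A = W
      · rw [h] at h1
        linarith
      · have := hmin _ (union_subset (hY.trans sdiff_subset) hAW) (hYne.mono subset_union_left) h
        linarith
    obtain ⟨M', hM'⟩ := IH _ (card_lt_card (sdiff_ssubset hAW ⟨b, hb⟩)) G k hk hgood
    have hM := hmono b M hM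
    have hz : ∀ S ⊆ A, ∀ T ⊆ W \ A, adjCount G S T ≤ 1 := fun S hS T hT => by
      have := adjCount_mono G hT hS
      rw [adjCount_comm]
      linarith
    refine ⟨M ∪ M', hAZ ▸ hM.union hM' hd (hz _ hM.subset _ hM'.subset)
      (hM.forest_right.union hM'.forest_right (hd.mono sdiff_subset sdiff_subset)
        (hz _ sdiff_subset _ sdiff_subset)) fun u hu v hv hadj => ?_⟩
    have := adjCount_pos G (hM'.subset hv) (hM.subset hu) hadj.symm
    linarith

lemma two_le_degree_of_not_colOn (hcol : ¬ ColOn G k W) {v : V} (hv : v ∈ W)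
    (h : ColOn G k (W.erase v)) : 2 ≤ adjCount G {v} (W.erase v) ∧
      (1 ≤ k v → 3 ≤ adjCount G {v} (W.erase v)) := by
  constructor
  · by_contra! hlt
    exact hcol (colOn_of_erase hv h (fun _ => le_rfl) (Or.inl (by linarith)))
  · intro hkv
    by_contra! hlt
    exact hcol (colOn_of_erase hv h (fun _ => le_rfl) (Or.inr (Or.inl ⟨by linarith, hkv⟩)))

lemma exists_min_pot (D : ℕ) (G : SimpleGraph V) (k : V → ℕ) {B : Finset V} (hBW : B ⊆ W)
    (hB : B.Nonempty) (hne : B ≠ W) : ∃ A ⊆ W, A.Nonempty ∧ A ≠ W ∧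
      ∀ B ⊆ W, B.Nonempty → B ≠ W → pot D G k A ≤ pot D G k B := by
  obtain ⟨A, hA, hmin⟩ := exists_min_image (W.powerset.filter fun A => A.Nonempty ∧ A ≠ W)
    (pot D G k) ⟨B, by simp [hBW, hB, hne]⟩
  simp only [mem_filter, mem_powerset] at hA hmin
  exact ⟨A, hA.1, hA.2.1, hA.2.2, fun B h1 h2 h3 => hmin B ⟨h1, h2, h3⟩⟩

/-- If all nonempty subsets of `W` have potential at least `-2`, then `W` can be coloured. -/
theorem colOn_of_potGE (hD : 2 ≤ D) (W : Finset V) (G : SimpleGraph V) (k : V → ℕ)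
    (hk : ∀ v, k v ≤ D + 1) (hgood : PotGE D G k W) : ColOn G k W := by
  induction hn : #W using Nat.strong_induction_on generalizing W G k with
  | _ n ih =>
  subst hn
  have IH : ∀ (W' : Finset V), #W' < #W → ∀ (G' : SimpleGraph V) (k' : V → ℕ),
      (∀ v, k' v ≤ D + 1) → PotGE D G' k' W' → ColOn G' k' W' :=
    fun W' h G' k' h1 h2 => ih _ h W' G' k' h1 h2 rfl
  by_contra hcol
  have hWne : W.Nonempty := by
    by_contra h
    rw [not_nonempty_iff_eq_empty.1 h] at hcol
    exact hcol colOn_empty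
  have hdeg : ∀ v ∈ W, 2 ≤ adjCount G {v} (W.erase v) ∧
      (1 ≤ k v → 3 ≤ adjCount G {v} (W.erase v)) := fun v hv =>
    two_le_degree_of_not_colOn hcol hv (IH _ (card_erase_lt_of_mem hv) G k hk
      fun A hA => hgood A (hA.trans (erase_subset _ _)))
  have hcard : 3 ≤ #W := by
    obtain ⟨v, hv⟩ := hWne
    have h1 := (hdeg v hv).1
    rw [adjCount_singleton_left] at h1
    have h2 := card_filter_le (W.erase v) (fun u => G.Adj v u)
    rw [card_erase_of_mem hv] at h2
    omega
  obtain ⟨v₀, hv₀⟩ := hWne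
  obtain ⟨A, hAW, hA, hAne, hmin⟩ := exists_min_pot D G k (singleton_subset_iff.2 hv₀)
    (singleton_nonempty v₀) (by rintro h; rw [← h] at hcard; simp at hcard)
  have hgap : 3 * (D : ℤ) + 2 ≤ pot D G k A := by
    by_contra! hlt
    have hr := hgood A hAW hA
    -- Here `t` is `pot A / 3` rounded up: large enough for `pot A ≤ 3t`, while `3t ≤ pot A + 2`, so
    -- lowering one weight by `t` keeps every subset of `A` at `-2` or above.
    refine hcol (colOn_of_pot_le hAW hA hAne hk IH (hgood W subset_rfl ⟨v₀, hv₀⟩) hmin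
      (by linarith) hdeg (t := ((pot D G k A + 2) / 3).toNat) (by omega) fun b hb => ?_)
    refine IH A (card_lt_card (hAW.ssubset_of_ne hAne)) G _ (fun v => ?_) ?_
    · by_cases h : v = b
      · subst h; simp; have := hk v; omega
      · simpa [h] using hk v
    · intro S hS hSne
      have hSW : S ≠ W := fun h => hAne (hAW.antisymm (h ▸ hS))
      have h1 := hmin S (hS.trans hAW) hSne hSW
      have h2 : pot D G k S ≤ pot D G (Function.update k b (k b -
          ((pot D G k A + 2) / 3).toNat)) S
          + ∑ v ∈ S, if b = v then 3 * ((pot D G k A + 2) / 3) else 0 := by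
        refine pot_sub_pot_le fun v _ => ?_
        by_cases h : v = b
        · subst h
          simp only [Function.update_self, if_true]
          omega
        · simp [h, Ne.symm h]
      rw [sum_ite_eq] at h2
      split_ifs at h2 <;> omega
  -- Lowering the weights of at most three neighbours by one costs at most 9, and `3D + 2 - 9 ≥ -2`
  -- because `D ≥ 2`.
  have hdeg' : ∀ v ∈ W, 2 ≤ k v → 4 ≤ adjCount G {v} (W.erase v) := by
    intro v hv hkv
    by_contra! hlt
    set k' : V → ℕ := fun u => if G.Adj v u then k u - 1 else k u with hk'
    have hk'k : ∀ u, k' u ≤ k u := fun u => by simp only [hk']; split_ifs <;> simp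
    refine hcol (colOn_of_erase hv (k' := k') (IH _ (card_erase_lt_of_mem hv) G k'
      (fun u => (hk'k u).trans (hk u)) ?_) hk'k (Or.inr (Or.inr ⟨by linarith, hkv, ?_⟩)))
    · intro S hS hSne
      have h1 := hmin S (hS.trans (erase_subset _ _)) hSne (by
        rintro rfl
        exact notMem_erase v S (hS hv))
      have h2 : pot D G k S ≤ pot D G k' S + ∑ u ∈ S, 3 * adjCount G {v} {u} := by
        refine pot_sub_pot_le fun u _ => ?_
        rw [adjCount_singleton]
        simp only [hk']
        split_ifs <;> omega
      have h3 : ∑ u ∈ S, adjCount G {v} {u} = adjCount G {v} S := by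
        rw [adjCount_comm, adjCount_eq_sum]
        exact sum_congr rfl fun u _ => adjCount_comm G _ _
      rw [← mul_sum, h3] at h2
      have h4 := adjCount_mono G (subset_refl {v}) hS
      have : (2 : ℤ) ≤ D := by exact_mod_cast hD
      linarith
    · intro u hu
      simp only [hk', hu, if_true]
      omega
  have hDz : (2 : ℤ) ≤ D := by exact_mod_cast hD
  have hsum : 2 * pot D G k W = ∑ v ∈ W, (2 * (3 * (D : ℤ) + 2 + 3 * k v)
      - (3 * D + 3) * adjCount G {v} W) := by
    rw [sum_sub_distrib, ← mul_sum, ← mul_sum, ← adjCount_eq_sum, ← two_mul_edgeCount, pot]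
    ring
  have hle : ∑ v ∈ W, (2 * (3 * (D : ℤ) + 2 + 3 * k v) - (3 * D + 3) * adjCount G {v} W)
      ≤ ∑ v ∈ W, (-2 : ℤ) := by
    -- Weight `0` with degree 2, and weight `D + 1` with degree 4, both give exactly `-2`.
    refine sum_le_sum fun v hv => ?_
    have h0 := adjCount_mono G (subset_refl {v}) (erase_subset v W)
    have h1 := hdeg v hv
    have h2 := hdeg' v hv
    have h3 := hk v
    rcases Nat.lt_or_ge (k v) 2 with h | h
    · have : k v = 0 ∨ k v = 1 := by omega
      rcases this with h | h
      · rw [h]; push_cast; nlinarith [h1.1]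
      · rw [h]; push_cast; nlinarith [h1.2 h.ge]
    · have h4 := h2 h
      have : (k v : ℤ) ≤ D + 1 := by exact_mod_cast h3
      nlinarith
  rw [← hsum, sum_const, nsmul_eq_mul] at hle
  have h1 := hgood W subset_rfl ⟨v₀, hv₀⟩
  have : (3 : ℤ) ≤ #W := by exact_mod_cast hcard
  linarith

/-- If `W` cannot be coloured but all its proper subsets can, then its potential is at most
`-3`. -/
theorem pot_le_of_not_colOn (hD : 2 ≤ D) (hk : ∀ v, k v ≤ D + 1) (hcol : ¬ ColOn G k W)
    (hprop : ∀ A ⊆ W, A ≠ W → ColOn G k A) : pot D G k W ≤ -3 := by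
  by_contra! hlt
  have : ∃ B ⊆ W, B.Nonempty ∧ pot D G k B < -2 := by
    by_contra! h
    exact hcol (colOn_of_potGE hD W G k hk fun A hA hne => h A hA hne)
  obtain ⟨B, hBW, hB, hBpot⟩ := this
  have hne : B ≠ W := by rintro rfl; linarith
  obtain ⟨A, hAW, hA, hAne, hmin⟩ := exists_min_pot D G k hBW hB hne
  have hAB := hmin B hBW hB hne
  -- As `pot A < 0`, the choice `t = 0` suffices, so the assumed colourings of proper subsets are
  -- used without reduced weights.
  refine hcol (colOn_of_pot_le hAW hA hAne hk (fun W' _ G' k' h1 h2 => colOn_of_potGE hD W' G' k'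
    h1 h2) (by linarith) hmin (by linarith) (fun v hv => two_le_degree_of_not_colOn hcol hv
      (hprop _ (erase_subset _ _) fun h => ?_)) (t := 0) (by push_cast; linarith) fun b hb => ?_)
  · exact notMem_erase v W (h.symm ▸ hv)
  · simpa using hprop A hAW hAne

end Gap

end

/-! ### Transfer to forests and colourings of simple graphs; the lower bound -/

section

variable {V : Type*}

section Transfer

variable {U : Type*} {G : SimpleGraph V} {k : V → ℕ}

lemma adjCount_comap (f : U ↪ V) (A B : Finset U) :
    adjCount (G.comap f) A B = adjCount G (A.map f) (B.map f) := by
  simp only [adjCount, sum_map, SimpleGraph.comap_adj]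

lemma edgeCount_comap (f : U ↪ V) (A : Finset U) :
    edgeCount (G.comap f) A = edgeCount G (A.map f) := by
  simp only [edgeCount, adjCount_comap]

lemma pot_comap {D : ℕ} (f : U ↪ V) (A : Finset U) :
    pot D (G.comap f) (k ∘ f) A = pot D G k (A.map f) := by
  simp [pot, edgeCount_comap, sum_map]

lemma forestOn_comap (f : U ↪ V) (S : Finset U) :
    ForestOn (G.comap f) S ↔ ForestOn G (S.map f) := by
  constructor
  · intro h T hT hne
    obtain ⟨T', hT', rfl⟩ := subset_map_iff.1 hT
    have := h T' hT' (by simpa using hne)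
    rwa [edgeCount_comap, ← card_map f] at this
  · intro h T hT hne
    have := h (T.map f) (map_subset_map.2 hT) (by simpa using hne)
    rwa [← edgeCount_comap, card_map f] at this

lemma ColOn.map [DecidableEq U] [DecidableEq V] (f : U ↪ V) {S : Finset U} (h : ColOn (G.comap f) (k ∘ f) S) :
    ColOn G k (S.map f) := by
  obtain ⟨M, hM⟩ := h
  refine ⟨M.map f, map_subset_map.2 hM.subset, (forestOn_comap f M).1 hM.forest_left, ?_, ?_⟩
  · intro v hv
    obtain ⟨u, hu, rfl⟩ := mem_map.1 hv
    have := hM.degree_lt u hu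
    rwa [adjCount_comap, map_singleton] at this
  · rw [← Finset.map_sdiff]
    exact (forestOn_comap f _).1 hM.forest_right

lemma two_mul_card_edgeFinset [Fintype U] (H : SimpleGraph U) :
    adjCount H univ univ = 2 * #H.edgeFinset := by
  rw [adjCount_eq_sum]
  have := H.sum_degrees_eq_twice_card_edges
  simp only [adjCount_singleton_left]
  have h2 : ∀ u, #{v | H.Adj u v} = H.degree u := fun u => by
    rw [← SimpleGraph.card_neighborFinset_eq_degree, SimpleGraph.neighborFinset_eq_filter]
  simp only [h2]
  exact_mod_cast this

lemma edgeCount_univ [Fintype U] (H : SimpleGraph U) : edgeCount H univ = H.edgeSet.ncard := by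
  have h1 := two_mul_edgeCount H univ
  rw [two_mul_card_edgeFinset] at h1
  rw [← SimpleGraph.coe_edgeFinset, Set.ncard_coe_finset]
  linarith

lemma SimpleGraph.IsAcyclic.ncard_edgeSet_add_one_le [Fintype U] [Nonempty U] {H : SimpleGraph U}
    (h : H.IsAcyclic) : H.edgeSet.ncard + 1 ≤ Fintype.card U := by
  obtain ⟨T, hHT, -, hT⟩ := SimpleGraph.connected_top.exists_isTree_le_of_le_of_isAcyclic
    (le_top : H ≤ ⊤) h
  rw [← hT.card_edgeFinset, ← Set.ncard_coe_finset, SimpleGraph.coe_edgeFinset]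
  exact Nat.add_le_add_right (Set.ncard_le_ncard (SimpleGraph.edgeSet_mono hHT)
    (Set.toFinite _)) 1

lemma univ_map_subtype (S : Finset V) :
    (univ : Finset S).map (Function.Embedding.subtype (· ∈ S)) = S := by
  ext; simp

/-- The vertices of a cycle each have two neighbours among themselves, so they span at least as many
edges as vertices. Conversely, an acyclic graph extends to a spanning tree of the complete graph. -/
lemma forestOn_univ_iff [Fintype U] (H : SimpleGraph U) : ForestOn H univ ↔ H.IsAcyclic := by
  constructor
  · intro h v p hp
    set T := p.support.toFinset with hT
    have hvT : v ∈ T := by simp [hT]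
    have h1 := h T (subset_univ _) ⟨v, hvT⟩
    have h2 := two_mul_edgeCount H T
    have h3 : ∑ w ∈ T, (2 : ℤ) ≤ ∑ w ∈ T, adjCount H {w} T := by
      refine sum_le_sum fun w hw => ?_
      have h4 := hp.ncard_neighborSet_toSubgraph_eq_two (by simpa [hT] using hw : w ∈ p.support)
      rw [adjCount_singleton_left, ← Set.ncard_coe_finset]
      have : (p.toSubgraph.neighborSet w).ncard ≤
          (({u ∈ T | H.Adj w u} : Finset U) : Set U).ncard := by
        refine Set.ncard_le_ncard (fun u hu => ?_) (Set.toFinite _)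
        have hu' : p.toSubgraph.Adj w u := hu
        simp only [coe_filter, Set.mem_ofPred_eq, hT, List.mem_toFinset]
        exact ⟨p.mem_verts_toSubgraph.1 hu'.snd_mem, hu'.adj_sub⟩
      rw [h4] at this
      exact_mod_cast this
    rw [← adjCount_eq_sum, ← h2, sum_const, nsmul_eq_mul] at h3
    linarith
  · intro h T _ hne
    have : Nonempty T := hne.to_subtype
    have h1 := (h.of_comap (Function.Embedding.subtype (· ∈ T))).ncard_edgeSet_add_one_le
    have h2 := edgeCount_comap (G := H) (Function.Embedding.subtype (· ∈ T)) univ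
    rw [univ_map_subtype, edgeCount_univ] at h2
    rw [← h2]
    rw [Fintype.card_coe] at h1
    exact_mod_cast h1

lemma forestOn_iff (S : Finset V) : ForestOn G S ↔ (G.induce (S : Set V)).IsAcyclic := by
  have := forestOn_comap (G := G) (Function.Embedding.subtype (· ∈ S)) univ
  rw [univ_map_subtype] at this
  rw [← this]
  exact forestOn_univ_iff _

lemma encard_neighborSet_induce (S : Finset V) (v : (S : Set V)) :
    (((G.induce (S : Set V)).neighborSet v).encard.toNat : ℤ) = adjCount G {v.1} S ∧
      ((G.induce (S : Set V)).neighborSet v).encard ≠ ⊤ := by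
  have : ((G.induce (S : Set V)).neighborSet v).encard
      = (({u ∈ S | G.Adj v u} : Finset V) : Set V).encard := by
    rw [← Subtype.val_injective.encard_image]
    congr 1
    ext u
    simp [and_comm]
  rw [this, adjCount_singleton_left, Set.encard_coe_eq_coe_finsetCard]
  simp

lemma hasDFFColoring_iff [Fintype U] [DecidableEq U] (H : SimpleGraph U) (D : ℕ) :
    HasDFFColoring H D ↔ ColOn H (fun _ => D + 1) univ := by
  have key : ∀ M : Finset U, IsDFFColoring H D M ↔ IsColOn H (fun _ => D + 1) univ M := by
    intro M
    have hc : ((univ \ M : Finset U) : Set U) = (M : Set U)ᶜ := by simp [Set.compl_eq_univ_sdiff]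
    have hdeg : ∀ v (hv : v ∈ M), ((H.induce (M : Set U)).neighborSet ⟨v, hv⟩).encard ≤ D ↔
        adjCount H {v} M < ((D + 1 : ℕ) : ℤ) := by
      intro v hv
      obtain ⟨h1, h2⟩ := encard_neighborSet_induce (G := H) M ⟨v, hv⟩
      rw [← h1]
      obtain ⟨m, hm⟩ := ENat.ne_top_iff_exists.1 h2
      rw [← hm]
      simp only [ENat.toNat_natCast, Nat.cast_le, Nat.cast_lt]
      omega
    constructor
    · intro h
      refine ⟨subset_univ _, (forestOn_iff M).2 h.acyclic_left,
        fun v hv => (hdeg v hv).1 (h.degree_le ⟨v, hv⟩), (forestOn_iff _).2 ?_⟩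
      rw [hc]
      exact h.acyclic_right
    · intro h
      refine ⟨(forestOn_iff M).1 h.forest_left, fun v => (hdeg v.1 v.2).2 (h.degree_lt v.1 v.2), ?_⟩
      have := (forestOn_iff _).1 h.forest_right
      rwa [hc] at this
  constructor
  · rintro ⟨M, hM⟩
    exact ⟨M.toFinset, (key _).1 (by simpa using hM)⟩
  · rintro ⟨M, hM⟩
    exact ⟨M, (key M).2 hM⟩

end Transfer

theorem IsDFFCritical.le_edgeCount {D : ℕ} (hD : 2 ≤ D) [Fintype V] {G : SimpleGraph V}
    (h : IsDFFCritical G D) :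
    (6 * (D : ℤ) + 5) * Fintype.card V + 3 ≤ 3 * (D + 1) * G.edgeSet.ncard := by
  have h1 : pot D G (fun _ => D + 1) univ ≤ -3 := by
    refine pot_le_of_not_colOn hD (fun _ => le_rfl) (fun hc => h.1 ((hasDFFColoring_iff G D).2 hc))
      fun A _ hA => ?_
    set H : G.Subgraph := (⊤ : G.Subgraph).induce (A : Set V) with hH
    have hHA : H ≠ ⊤ := fun hH' => hA (by
      have : H.verts = Set.univ := by rw [hH']; rfl
      rw [SimpleGraph.Subgraph.induce_verts] at this
      exact_mod_cast this)
    have h2 := (hasDFFColoring_iff H.coe D).1 (h.2 H hHA)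
    have h3 : H.coe = G.comap (Function.Embedding.subtype (· ∈ H.verts)) := by
      ext u v
      have hu : u.1 ∈ A := u.2
      have hv : v.1 ∈ A := v.2
      simp [hH, hu, hv]
    rw [h3] at h2
    have h4 := ColOn.map (k := fun _ => D + 1) _ h2
    convert h4 using 1
    ext x
    simp [hH]
  rw [pot, edgeCount_univ, sum_const, nsmul_eq_mul, card_univ] at h1
  push_cast at h1
  linarith

end

/-! ### Sharpness: tight weighted graphs and attached triangles -/

section

/-- A weighted graph on `{0, …, n - 1}` that cannot be coloured, of potential `-3`, all of whose
proper nonempty subsets have potential at least `-2`. -/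
structure IsTight (D n : ℕ) (G : SimpleGraph ℕ) (k : ℕ → ℕ) : Prop where
  three_le : 3 ≤ n
  le : ∀ v, k v ≤ D + 1
  not_colOn : ¬ ColOn G k (range n)
  pot_eq : pot D G k (range n) = -3
  pot_ge : ∀ A ⊆ range n, A.Nonempty → A ≠ range n → -2 ≤ pot D G k A

lemma isTight_triangle (D : ℕ) : IsTight D 3 ⊤ (fun _ => 0) := by
  have h3 : range 3 = insert 0 (insert 1 {2}) := by
    ext x
    simp only [mem_range, mem_insert, mem_singleton]
    omega
  have e3 : edgeCount (⊤ : SimpleGraph ℕ) (range 3) = 3 := by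
    simp [edgeCount, adjCount, SimpleGraph.top_adj, h3]
  refine ⟨le_rfl, fun _ => Nat.zero_le _, ?_, ?_, ?_⟩
  · rintro ⟨M, hM⟩
    have hM0 : M = ∅ := eq_empty_of_forall_notMem fun v hv => by
      have h1 := hM.degree_lt v hv
      have h2 := adjCount_nonneg ⊤ {v} M
      push_cast at h1
      linarith
    have := hM.forest_right (range 3) (by simp [hM0]) (by simp)
    rw [e3] at this
    simp at this
  · rw [pot, e3]
    simp
    ring
  · intro A hA hne hA3
    have hlt := card_lt_card (hA.ssubset_of_ne hA3)
    rw [card_range] at hlt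
    have := hne.card_pos
    have h12 : #A = 1 ∨ #A = 2 := by omega
    rcases h12 with h | h
    · obtain ⟨a, rfl⟩ := card_eq_one.1 h
      rw [pot_singleton]
      push_cast
      linarith [(Nat.cast_nonneg D : (0 : ℤ) ≤ D)]
    · obtain ⟨a, b, hab, rfl⟩ := card_eq_two.1 h
      rw [pot_insert (by simpa using hab), pot_singleton, adjCount_singleton, if_pos (by simpa)]
      push_cast
      linarith [(Nat.cast_nonneg D : (0 : ℤ) ≤ D)]

/-- Attach to the vertex `v` of a graph on `{0, …, n - 1}` a triangle on `n, n + 1, n + 2`, where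
`n + 2` is joined to `v` only if `ε = 1`. -/
def attachTriangle (G : SimpleGraph ℕ) (n v ε : ℕ) : SimpleGraph ℕ :=
  SimpleGraph.fromRel fun a b => (a < n ∧ b < n ∧ G.Adj a b) ∨
    (a = v ∧ (b = n ∨ b = n + 1 ∨ (b = n + 2 ∧ ε = 1))) ∨
    (a = n ∧ b = n + 1) ∨ (a = n ∧ b = n + 2) ∨ (a = n + 1 ∧ b = n + 2)

/-- The weights on `attachTriangle G n v ε`. -/
def attachWeight (D : ℕ) (k : ℕ → ℕ) (n v ε : ℕ) : ℕ → ℕ := fun u =>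
  if u = v then k v + 1 else if u < n then k u else if u = n + 2 then (D + 1) * ε else D + 1

section Attach

variable {D n : ℕ} {G : SimpleGraph ℕ} {k : ℕ → ℕ} {v ε : ℕ}

lemma attachTriangle_adj {a b : ℕ} (ha : a < n) (hb : b < n) :
    (attachTriangle G n v ε).Adj a b ↔ G.Adj a b := by
  have h1 := G.adj_comm a b
  have h2 : G.Adj a b → a ≠ b := fun h => h.ne
  simp only [attachTriangle, SimpleGraph.fromRel_adj]
  constructor
  · rintro ⟨-, h | h⟩
    · rcases h with h | h
      · exact h.2.2
      · omega
    · rcases h with h | h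
      · exact h1.2 h.2.2
      · omega
  · exact fun h => ⟨h2 h, Or.inl (Or.inl ⟨ha, hb, h⟩)⟩

lemma attachTriangle_adj_new (hv : v < n) {a b : ℕ} (hb : n ≤ b) :
    (attachTriangle G n v ε).Adj a b ↔
      (a = v ∧ (b = n ∨ b = n + 1 ∨ (b = n + 2 ∧ ε = 1))) ∨
      (a ≠ b ∧ n ≤ a ∧ a ≤ n + 2 ∧ b ≤ n + 2) := by
  simp only [attachTriangle, SimpleGraph.fromRel_adj]
  omega

lemma attachTriangle_adj_triangle (hv : v < n) :
    (attachTriangle G n v ε).Adj n (n + 1) ∧ (attachTriangle G n v ε).Adj n (n + 2) ∧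
      (attachTriangle G n v ε).Adj (n + 1) (n + 2) := by
  refine ⟨?_, ?_, ?_⟩ <;> rw [attachTriangle_adj_new hv (by omega)] <;> omega

lemma edgeCount_attachTriangle (hv : v < n) :
    edgeCount (attachTriangle G n v ε) {n, n + 1, n + 2} = 3 := by
  obtain ⟨e01, e02, e12⟩ := attachTriangle_adj_triangle (G := G) (ε := ε) hv
  have d1 : Disjoint ({n + 1} : Finset ℕ) {n + 2} := by simp
  rw [insert_eq, insert_eq, edgeCount_union _ (by simp), edgeCount_union _ d1,
    adjCount_union_right _ d1]
  simp only [edgeCount_singleton, adjCount_singleton, e01, e02, e12, if_true]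
  norm_num

lemma adjCount_attachTriangle (hv : v < n) {A : Finset ℕ} (hA : A ⊆ range n) {b : ℕ}
    (hb : n ≤ b) (hb' : b = n ∨ b = n + 1 ∨ (b = n + 2 ∧ ε = 1)) :
    adjCount (attachTriangle G n v ε) {b} A = if v ∈ A then 1 else 0 := by
  rw [adjCount_comm, adjCount_eq_sum]
  have : ∀ a ∈ A, adjCount (attachTriangle G n v ε) {a} {b} = if v = a then 1 else 0 := by
    intro a ha
    have := mem_range.1 (hA ha)
    have h := attachTriangle_adj_new (G := G) (ε := ε) hv (a := a) hb
    rw [adjCount_singleton]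
    by_cases hva : v = a
    · rw [if_pos (h.2 (by omega)), if_pos hva]
    · rw [if_neg (fun hadj => by have := h.1 hadj; omega), if_neg hva]
  rw [sum_congr rfl this, sum_ite_eq]

lemma adjCount_attachTriangle_zero (hv : v < n) {A : Finset ℕ} (hA : A ⊆ range n) :
    adjCount (attachTriangle G n v 0) {n + 2} A = 0 := by
  refine adjCount_eq_zero _ fun b hb a ha hadj => ?_
  have := mem_range.1 (hA ha)
  rw [mem_singleton.1 hb, SimpleGraph.adj_comm, attachTriangle_adj_new hv (by omega)] at hadj
  omega

lemma pot_attach (hv : v < n) {A : Finset ℕ} (hA : A ⊆ range n) :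
    pot D (attachTriangle G n v ε) (attachWeight D k n v ε) A
      = pot D G k A + if v ∈ A then 3 else 0 := by
  unfold pot
  rw [edgeCount_congr (attachTriangle G n v ε) (G' := G) fun a ha b hb =>
    attachTriangle_adj (mem_range.1 (hA ha)) (mem_range.1 (hA hb))]
  have : ∀ a ∈ A, 3 * (D : ℤ) + 2 + 3 * attachWeight D k n v ε a
      = (3 * (D : ℤ) + 2 + 3 * k a) + if v = a then 3 else 0 := by
    intro a ha
    have := mem_range.1 (hA ha)
    by_cases h : a = v
    · subst h
      simp [attachWeight]
      ring
    · simp [attachWeight, h, Ne.symm h, this]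
  rw [sum_congr rfl this, sum_add_distrib, sum_ite_eq]
  ring

lemma eq_or_of_subset_triple {a b c : ℕ} {S : Finset ℕ} (hS : S ⊆ {a, b, c}) :
    S = ∅ ∨ S = {a} ∨ S = {b} ∨ S = {c} ∨ S = {a, b} ∨ S = {a, c} ∨ S = {b, c} ∨
      S = {a, b, c} := by
  rw [subset_insert_iff] at hS
  have h : S.erase a = ∅ ∨ S.erase a = {b} ∨ S.erase a = {c} ∨ S.erase a = {b, c} := by
    rwa [← coe_subset, coe_pair, Set.subset_pair_iff_eq, coe_eq_empty, coe_eq_singleton,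
      coe_eq_singleton, ← coe_pair, coe_inj] at hS
  by_cases ha : a ∈ S
  · rw [← insert_erase ha]
    rcases h with h | h | h | h <;> rw [h] <;> simp
  · rw [erase_eq_of_notMem ha] at h
    tauto

/-- When `v ∈ A`, its extra unit of weight adds 3. The full triangle with its edges to `v`
contributes exactly `-3`, and any proper part of it contributes at least `0`. -/
lemma pot_attach_union (hv : v < n) (hε : ε = 0 ∨ ε = 1) {A S : Finset ℕ} (hA : A ⊆ range n)
    (hS : S ⊆ {n, n + 1, n + 2}) :
    pot D G k A ≤ pot D (attachTriangle G n v ε) (attachWeight D k n v ε) (S ∪ A) ∧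
    (S ≠ {n, n + 1, n + 2} → v ∈ A →
      pot D G k A + 3 ≤ pot D (attachTriangle G n v ε) (attachWeight D k n v ε) (S ∪ A)) ∧
    (S = {n, n + 1, n + 2} → v ∈ A →
      pot D (attachTriangle G n v ε) (attachWeight D k n v ε) (S ∪ A) = pot D G k A) := by
  have hn : n ∉ A := fun h => by simpa using hA h
  have hn1 : n + 1 ∉ A := fun h => by simpa using hA h
  have hn2 : n + 2 ∉ A := fun h => by simpa using hA h
  obtain ⟨e01, e02, e12⟩ := attachTriangle_adj_triangle (G := G) (ε := ε) hv
  have hpA := pot_attach (D := D) (G := G) (k := k) (ε := ε) hv hA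
  have c0 := adjCount_attachTriangle (G := G) (ε := ε) hv hA le_rfl (Or.inl rfl)
  have c1 := adjCount_attachTriangle (G := G) (ε := ε) hv hA (Nat.le_add_right n 1)
    (Or.inr (Or.inl rfl))
  have c2 : adjCount (attachTriangle G n v ε) {n + 2} A = if v ∈ A then (ε : ℤ) else 0 := by
    rcases hε with rfl | rfl
    · rw [adjCount_attachTriangle_zero hv hA]; simp
    · rw [adjCount_attachTriangle hv hA (by omega) (by simp)]; simp
  have k0 : attachWeight D k n v ε n = D + 1 := by
    have : n ≠ v := by omega
    simp [attachWeight, this]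
  have k1 : attachWeight D k n v ε (n + 1) = D + 1 := by
    have : n + 1 ≠ v := by omega
    simp [attachWeight, this]
  have k2 : attachWeight D k n v ε (n + 2) = (D + 1) * ε := by
    have : n + 2 ≠ v := by omega
    simp [attachWeight, this]
  have s01 := adjCount_singleton (attachTriangle G n v ε) n (n + 1)
  have s02 := adjCount_singleton (attachTriangle G n v ε) n (n + 2)
  have s12 := adjCount_singleton (attachTriangle G n v ε) (n + 1) (n + 2)
  rw [if_pos e01] at s01
  rw [if_pos e02] at s02
  rw [if_pos e12] at s12
  have hpS : ∀ S : Finset ℕ, Disjoint S A → _ := fun S h =>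
    pot_union (D := D) (G := attachTriangle G n v ε) (k := attachWeight D k n v ε) h
  have hD0 : (0 : ℤ) ≤ D := by positivity
  have a0 : adjCount (attachTriangle G n v ε) {n} {n + 1, n + 2} = 2 := by
    rw [insert_eq, adjCount_union_right _ (by simp), s01, s02]; norm_num
  have p0 : pot D (attachTriangle G n v ε) (attachWeight D k n v ε) {n} = 6 * D + 5 := by
    rw [pot_singleton, k0]; push_cast; ring
  have p1 : pot D (attachTriangle G n v ε) (attachWeight D k n v ε) {n + 1} = 6 * D + 5 := by
    rw [pot_singleton, k1]; push_cast; ring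
  have p2 : pot D (attachTriangle G n v ε) (attachWeight D k n v ε) {n + 2}
      = 3 * D + 2 + 3 * (D + 1) * ε := by
    rw [pot_singleton, k2]; push_cast; ring
  have p01 : pot D (attachTriangle G n v ε) (attachWeight D k n v ε) {n, n + 1} = 9 * D + 7 := by
    rw [pot_insert (by simp), p1, k0, s01]; push_cast; ring
  have p02 : pot D (attachTriangle G n v ε) (attachWeight D k n v ε) {n, n + 2}
      = 6 * D + 4 + 3 * (D + 1) * ε := by
    rw [pot_insert (by simp), p2, k0, s02]; push_cast; ring
  have p12 : pot D (attachTriangle G n v ε) (attachWeight D k n v ε) {n + 1, n + 2}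
      = 6 * D + 4 + 3 * (D + 1) * ε := by
    rw [pot_insert (by simp), p2, k1, s12]; push_cast; ring
  have p012 : pot D (attachTriangle G n v ε) (attachWeight D k n v ε) {n, n + 1, n + 2}
      = 6 * D + 3 + 3 * (D + 1) * ε := by
    rw [pot_insert (by simp), p12, k0, a0]; push_cast; ring
  have d12 := adjCount_union_left (attachTriangle G n v ε) (A := {n + 1}) (B := {n + 2})
    (by simp) A
  have d01 := adjCount_union_left (attachTriangle G n v ε) (A := {n}) (B := {n + 1}) (by simp) A
  have d02 := adjCount_union_left (attachTriangle G n v ε) (A := {n}) (B := {n + 2}) (by simp) A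
  have d012 := adjCount_union_left (attachTriangle G n v ε) (A := {n}) (B := {n + 1, n + 2})
    (by simp) A
  rw [← insert_eq] at d12 d01 d02 d012
  have hdS : Disjoint S A := by
    refine disjoint_left.2 fun x hx hxA => ?_
    have := hS hx
    simp only [mem_insert, mem_singleton] at this
    rcases this with rfl | rfl | rfl <;> contradiction
  have hεz : (0 : ℤ) ≤ ε ∧ (ε : ℤ) ≤ 1 := by omega
  have hεD : (0 : ℤ) ≤ D * ε := by positivity
  have hu := hpS S hdS
  rw [hpA] at hu
  clear hpS hpA k0 k1 k2 s01 s02 s12 a0 e01 e02 e12 hdS hn hn1 hn2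
  have hne : ∀ T : Finset ℕ, #T < 3 → T ≠ {n, n + 1, n + 2} := by
    rintro T hT rfl
    simp at hT
  rcases eq_or_of_subset_triple hS with rfl | rfl | rfl | rfl | rfl | rfl | rfl | rfl <;>
  first
  | simp only [pot_empty, adjCount_empty_left] at hu
    refine ⟨?_, fun _ hvA => ?_, fun h _ => (hne _ (by simp) h).elim⟩
    · split_ifs at hu <;> linarith
    · simp only [hvA, if_true] at hu
      linarith
  | simp only [p0, p1, p2, p01, p02, p12, d01, d02, d12, c0, c1, c2] at hu
    refine ⟨?_, fun _ hvA => ?_, fun h _ => (hne _ (by simp) h).elim⟩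
    · split_ifs at hu <;> linarith
    · simp only [hvA, if_true] at hu
      linarith
  | simp only [p012, d012, d12, c0, c1, c2] at hu
    refine ⟨?_, fun h _ => absurd rfl h, fun _ hvA => ?_⟩
    · split_ifs at hu <;> linarith
    · simp only [hvA, if_true] at hu
      linarith

/-- If `v` is in `M`, the triangle gives it a neighbour in `M`, which absorbs the added unit of
weight; so a colouring would restrict to one of the old weighted graph. -/
lemma IsTight.attach (h : IsTight D n G k) (hv : v < n) (hk : k v ≤ D) (hε : ε = 0 ∨ ε = 1) :
    IsTight D (n + 3) (attachTriangle G n v ε) (attachWeight D k n v ε) := by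
  have hrange : range (n + 3) = {n, n + 1, n + 2} ∪ range n := by
    ext x
    simp only [mem_range, mem_union, mem_insert, mem_singleton]
    omega
  have hd : Disjoint {n, n + 1, n + 2} (range n) := by
    rw [disjoint_left]
    intro x
    simp only [mem_range, mem_insert, mem_singleton]
    omega
  refine ⟨by omega, fun u => ?_, ?_, ?_, ?_⟩
  · have := h.le u
    unfold attachWeight
    rcases hε with rfl | rfl <;> split_ifs <;> omega
  · rintro ⟨M, hM⟩
    refine h.not_colOn ⟨M ∩ range n, inter_subset_right, ?_, ?_, ?_⟩
    · intro T hT hne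
      rw [edgeCount_congr G (G' := attachTriangle G n v ε) fun a ha b hb =>
        (attachTriangle_adj (mem_range.1 (inter_subset_right (hT ha)))
          (mem_range.1 (inter_subset_right (hT hb)))).symm]
      exact hM.forest_left T (hT.trans inter_subset_left) hne
    · intro u hu
      obtain ⟨huM, hun⟩ := mem_inter.1 hu
      rw [mem_range] at hun
      rw [adjCount_congr G (G' := attachTriangle G n v ε) fun a ha b hb =>
        (attachTriangle_adj (by rw [mem_singleton.1 ha]; exact hun)
          (mem_range.1 (inter_subset_right hb))).symm]
      have h1 := hM.degree_lt u huM
      by_cases huv : u = v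
      · subst huv
        -- The triangle cannot lie entirely in the right class. For `ε = 0` the vertex `n + 2`, not
        -- joined to `v`, has weight `0` and is not in `M`.
        have h2 : ∃ b ∈ M, n ≤ b ∧ (b = n ∨ b = n + 1 ∨ (b = n + 2 ∧ ε = 1)) := by
          by_contra! hno
          have hn0 : n ∉ M := fun hm => (hno n hm le_rfl).1 rfl
          have hn1 : n + 1 ∉ M := fun hm => (hno (n + 1) hm (by omega)).2.1 rfl
          have hn2 : n + 2 ∉ M := fun hm => by
            rcases hε with hε | hε
            · have h3 := hM.degree_lt _ hm
              have h4 := adjCount_nonneg (attachTriangle G n u ε) {n + 2} M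
              have h5 : attachWeight D k n u ε (n + 2) = 0 := by
                have : n + 2 ≠ u := by omega
                simp [attachWeight, hε, this]
              rw [h5] at h3
              push_cast at h3
              linarith
            · exact (hno (n + 2) hm (by omega)).2.2 rfl hε
          have h3 := hM.forest_right {n, n + 1, n + 2} (by
            rw [hrange]
            intro x hx
            refine mem_sdiff.2 ⟨mem_union_left _ hx, ?_⟩
            simp only [mem_insert, mem_singleton] at hx
            rcases hx with rfl | rfl | rfl <;> assumption) (by simp)
          rw [edgeCount_attachTriangle hv] at h3
          have h6 : #({n, n + 1, n + 2} : Finset ℕ) ≤ 3 := card_le_three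
          have : (#({n, n + 1, n + 2} : Finset ℕ) : ℤ) ≤ 3 := by exact_mod_cast h6
          linarith
        obtain ⟨b, hbM, hbn, hb⟩ := h2
        have h3 : adjCount (attachTriangle G n u ε) {u} (M ∩ range n ∪ {b})
            ≤ adjCount (attachTriangle G n u ε) {u} M :=
          adjCount_mono _ subset_rfl (union_subset inter_subset_left (by simpa using hbM))
        rw [adjCount_union_right _ (by simp; omega), adjCount_comm _ {u} {b},
          adjCount_attachTriangle hv (by simpa using hun) hbn hb] at h3
        simp only [attachWeight, if_true] at h1
        push_cast at h1
        simp only [mem_singleton, if_true] at h3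
        linarith
      · simp only [attachWeight, huv, if_false, hun, if_true] at h1
        exact (adjCount_mono _ subset_rfl inter_subset_left).trans_lt h1
    · intro T hT hne
      rw [edgeCount_congr G (G' := attachTriangle G n v ε) fun a ha b hb =>
        (attachTriangle_adj (mem_range.1 (sdiff_subset (hT ha)))
          (mem_range.1 (sdiff_subset (hT hb)))).symm]
      refine hM.forest_right T (fun x hx => ?_) hne
      obtain ⟨h1, h2⟩ := mem_sdiff.1 (hT hx)
      refine mem_sdiff.2 ⟨by rw [hrange]; exact mem_union_right _ h1, fun hm => h2 ?_⟩
      exact mem_inter.2 ⟨hm, h1⟩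
  · rw [hrange, (pot_attach_union hv hε subset_rfl subset_rfl).2.2 rfl (mem_range.2 hv), h.pot_eq]
  · intro B hB hne hBn
    have hBS : B = (B ∩ {n, n + 1, n + 2}) ∪ (B ∩ range n) := by
      rw [← inter_union_distrib_left, ← hrange, inter_eq_left.2 hB]
    obtain ⟨h1, h3, -⟩ := pot_attach_union (D := D) (G := G) (k := k) hv hε
      (inter_subset_right (s₁ := B) (s₂ := range n))
      (inter_subset_right (s₁ := B) (s₂ := {n, n + 1, n + 2}))
    rw [← hBS] at h1 h3
    rcases (B ∩ range n).eq_empty_or_nonempty with he | he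
    · rw [he, pot_empty] at h1
      linarith
    · by_cases hfull : B ∩ range n = range n
      · rw [hfull, h.pot_eq] at h3
        have := h3 (fun hS => hBn (by rw [hBS, hS, hfull, hrange])) (mem_range.2 hv)
        linarith
      · exact (h.pot_ge _ inter_subset_right he hfull).trans h1

end Attach

/-- There are arbitrarily large tight weighted graphs with a vertex of less than full weight. -/
lemma exists_isTight (D N : ℕ) : ∃ n G k, N ≤ n ∧ IsTight D n G k ∧ ∃ v < n, k v ≤ D := by
  induction N with
  | zero => exact ⟨3, ⊤, _, by omega, isTight_triangle D, 0, by omega, by omega⟩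
  | succ N ih =>
    obtain ⟨n, G, k, hn, h, v, hv, hk⟩ := ih
    -- The choice `ε = 0` leaves a new vertex of weight `0`, so the growth can continue.
    refine ⟨n + 3, _, _, by omega, h.attach hv hk (Or.inl rfl), n + 2, by omega, ?_⟩
    have : n + 2 ≠ v := by omega
    simp [attachWeight, this]

/-- Attaching with `ε = 1` adds only vertices of full weight and lowers the total deficiency by one.
-/
lemma IsTight.exists_full {D n : ℕ} {G : SimpleGraph ℕ} {k : ℕ → ℕ} (h : IsTight D n G k) :
    ∃ n' G' k', n ≤ n' ∧ IsTight D n' G' k' ∧ ∀ v < n', k' v = D + 1 := by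
  induction hm : ∑ v ∈ range n, (D + 1 - k v) generalizing n G k with
  | zero =>
    refine ⟨n, G, k, le_rfl, h, fun v hv => ?_⟩
    have h1 := (sum_eq_zero_iff.1 hm) v (mem_range.2 hv)
    have := h.le v
    omega
  | succ m ih =>
    obtain ⟨v, hv, hpos⟩ : ∃ v ∈ range n, D + 1 - k v ≠ 0 := by
      by_contra! h0
      rw [sum_eq_zero h0] at hm
      omega
    rw [mem_range] at hv
    have hkv : k v ≤ D := by omega
    obtain ⟨n', G', k', h1, h2, h3⟩ := ih (h.attach hv hkv (Or.inr rfl)) (by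
      have e1 : ∀ u ∈ range n, D + 1 - k u = (D + 1 - attachWeight D k n v 1 u)
          + if v = u then 1 else 0 := by
        intro u hu
        rw [mem_range] at hu
        by_cases huv : u = v
        · subst huv
          simp only [attachWeight, if_true]
          omega
        · simp [attachWeight, huv, Ne.symm huv, hu]
      rw [sum_congr rfl e1, sum_add_distrib, sum_ite_eq, if_pos (mem_range.2 hv)] at hm
      rw [sum_range_succ, sum_range_succ, sum_range_succ, add_right_cancel hm]
      have a1 : n ≠ v := by omega
      have a2 : n + 1 ≠ v := by omega
      have a3 : n + 2 ≠ v := by omega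
      simp [attachWeight, a1, a2, a3])
    exact ⟨n', G', k', by omega, h2, h3⟩

lemma edgeCount_lt_of_lt {V : Type*} [Fintype V] {H G : SimpleGraph V} (h : H ≤ G) (hne : H ≠ G) :
    edgeCount H univ + 1 ≤ edgeCount G univ := by
  rw [edgeCount_univ, edgeCount_univ]
  have := Set.ncard_lt_ncard (SimpleGraph.edgeSet_strict_mono (lt_of_le_of_ne h hne))
    (Set.toFinite _)
  exact_mod_cast this

lemma edgeCount_le_of_le {V : Type*} {H G : SimpleGraph V} (h : H ≤ G) (A : Finset V) :
    edgeCount H A ≤ edgeCount G A := by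
  refine Int.ediv_le_ediv (by norm_num) (sum_le_sum fun u _ => sum_le_sum fun v _ => ?_)
  have := @h u v
  split_ifs <;> tauto

/-- A graph that cannot be coloured, all of whose proper subsets have potential at least `-2` and
which has potential `-3`, is critical. -/
lemma isDFFCritical_of_pot {D : ℕ} (hD : 2 ≤ D) {V : Type*} [Fintype V] [DecidableEq V]
    {G : SimpleGraph V} (hcol : ¬ ColOn G (fun _ => D + 1) univ) (hpot : pot D G (fun _ => D + 1) univ = -3)
    (hprop : ∀ A : Finset V, A.Nonempty → A ≠ univ → -2 ≤ pot D G (fun _ => D + 1) A) :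
    IsDFFCritical G D := by
  refine ⟨fun h => hcol ((hasDFFColoring_iff G D).1 h), fun H hH => (hasDFFColoring_iff _ D).2 ?_⟩
  refine colOn_of_potGE hD _ _ _ (fun _ => le_rfl) fun A _ hA => ?_
  have h1 : H.coe = H.spanningCoe.comap (Function.Embedding.subtype (· ∈ H.verts)) := by
    ext u v
    simp
  have h2 := pot_comap (G := H.spanningCoe) (k := fun _ => D + 1) (D := D)
    (Function.Embedding.subtype (· ∈ H.verts)) A
  rw [← h1] at h2
  change pot D H.coe (fun _ => D + 1) A = _ at h2
  rw [h2]
  set B := A.map (Function.Embedding.subtype (· ∈ H.verts)) with hB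
  have hD0 : (0 : ℤ) ≤ 3 * D + 3 := by positivity
  -- If `B` is everything, then `H` has all the vertices and misses an edge, which lifts the
  -- potential from `-3` to at least `3D`. For other `B`, losing edges only raises the potential.
  by_cases hBu : B = univ
  · have hlt := edgeCount_lt_of_lt H.spanningCoe_le fun he => hH (by
      have hv : H.verts = Set.univ := Set.eq_univ_of_forall fun x => by
        have : x ∈ B := hBu ▸ mem_univ x
        obtain ⟨y, -, rfl⟩ := mem_map.1 this
        exact y.2
      refine SimpleGraph.Subgraph.ext hv ?_
      ext u w
      exact (by rw [← H.spanningCoe_adj, he]; rfl))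
    rw [hBu]
    unfold pot at hpot ⊢
    nlinarith
  · have h3 := hprop B (by simpa [hB] using hA) hBu
    have h4 := edgeCount_le_of_le H.spanningCoe_le B
    unfold pot at h3 ⊢
    nlinarith

theorem exists_isDFFCritical {D : ℕ} (hD : 2 ≤ D) (N : ℕ) :
    ∃ (n : ℕ) (G : SimpleGraph (Fin n)), N ≤ n ∧ 3 ≤ n ∧ IsDFFCritical G D ∧
      3 * ((D : ℤ) + 1) * G.edgeSet.ncard = (6 * D + 5) * n + 3 := by
  obtain ⟨n₀, G₀, k₀, hn₀, h₀, -⟩ := exists_isTight D N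
  obtain ⟨n, G, k, hn, h, hk⟩ := h₀.exists_full
  have hu : (univ : Finset (Fin n)).map Fin.valEmbedding = range n := by
    ext x
    simp only [mem_map, mem_univ, true_and, mem_range]
    exact ⟨fun ⟨a, ha⟩ => ha ▸ a.2, fun hx => ⟨⟨x, hx⟩, rfl⟩⟩
  have hkf : k ∘ Fin.valEmbedding = fun _ : Fin n => D + 1 := funext fun x => hk x x.2
  have hp : ∀ A : Finset (Fin n), pot D (G.comap Fin.valEmbedding) (fun _ => D + 1) A
      = pot D G k (A.map Fin.valEmbedding) := fun A => by rw [← pot_comap, hkf]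
  have hpu := hp univ
  rw [hu, h.pot_eq] at hpu
  refine ⟨n, G.comap Fin.valEmbedding, hn₀.trans hn, h.three_le, isDFFCritical_of_pot hD
    (fun hc => h.not_colOn ?_) hpu fun A hA hne => ?_, ?_⟩
  · rw [← hkf] at hc
    rw [← hu]
    exact hc.map _
  · rw [hp]
    refine h.pot_ge _ (hu ▸ map_subset_map.2 (subset_univ A)) (by simpa using hA) fun he => hne ?_
    rw [← hu] at he
    exact map_injective _ he
  · rw [pot, edgeCount_univ, sum_const, nsmul_eq_mul, card_univ, Fintype.card_fin] at hpu
    push_cast at hpu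
    linarith

end

end SparsePartition


theorem mainTheorem2 (D : ℕ) (hD : 2 ≤ D) :
    (∀ (V : Type*) [Fintype V] (G : SimpleGraph V), IsDFFCritical G D → 3 ≤ Fintype.card V →
      ((6 * (D : ℝ) + 5) * (Fintype.card V : ℝ) + 3) / (3 * ((D : ℝ) + 1)) ≤
        (G.edgeSet.ncard : ℝ)) ∧
    (∀ N : ℕ, ∃ (n : ℕ) (G : SimpleGraph (Fin n)), N ≤ n ∧ 3 ≤ n ∧ IsDFFCritical G D ∧
      (G.edgeSet.ncard : ℝ) = ((6 * (D : ℝ) + 5) * (n : ℝ) + 3) / (3 * ((D : ℝ) + 1))) := by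
  have hpos : (0 : ℝ) < 3 * ((D : ℝ) + 1) := by positivity
  constructor
  · intro V _ G hG _
    rw [div_le_iff₀ hpos, mul_comm (G.edgeSet.ncard : ℝ)]
    exact_mod_cast hG.le_edgeCount hD
  · intro N
    obtain ⟨n, G, h1, h2, h3, h4⟩ := exists_isDFFCritical hD N
    refine ⟨n, G, h1, h2, h3, ?_⟩
    rw [eq_div_iff hpos.ne', mul_comm (G.edgeSet.ncard : ℝ)]
    exact_mod_cast h4
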